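/- **Definitions.** All languages are over finite alphabets. A *finite automaton with nondeterministically translucent letters* (NFAwntl) is $A=(Q,\Sigma,\tau,I,F,\delta)$ with a finite set $Q$ of states, a finite alphabet $\Sigma$, a translucency mapping $\tau:Q\to 2^{\Sigma}$, sets $I,F\subseteq Q$ of initial and final states, and a transition relation $\delta:Q\times\Sigma\to 2^{Q}$ (a letter may be both in $\tau(q)$ and have $\delta(q,a)\neq\emptyset$). A computation step leads from a configuration $q\cdot ubv$ with $u\in\tau(q)^*$, $b\in\Sigma$, $v\in\Sigma^*$ to $p\cdot uv$ for some $p\in\delta(q,b)$. A word $w$ is accepted if from $q_0\cdot w$ for some $q_0\in I$ a configuration $q\cdot r$ with $q\in F$ and $r\in\tau(q)^*$ can be reached in finitely many (possibly zero) steps. $A$ is a DFAwntl if $|I|=1$ and $|\delta(q,a)|\le 1$ for all $q\in Q$, $a\in\Sigma$. A language is *deterministic context-free* if it is accepted, by final state, by a deterministic pushdown automaton, and *deterministic linear* if it is accepted by such an automaton that is one-turn (in no computation is a move decreasing the stack height followed later by a move increasing it). It is *linear context-free* if it is generated by a context-free grammar with at most one nonterminal on the right-hand side of each rule. It is in *2detLIN*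 if it is accepted by a deterministic $5'\to3'$ Watson–Crick finite automaton, i.e. a finite automaton with finitely many transitions $(q,u,v,p)\in Q\times\Sigma^*\times\Sigma^*\times Q$ and steps $(q,uwv)\Rightarrow(p,w)$, in which every configuration has at most one next configuration, and which accepts $w$ if $(q_0,w)\Rightarrow^*(f,\lambda)$ for some final state $f$. Two languages are *letter equivalent* if every word of either one is a permutation of some word of the other one. **Theorem.** (1) The class of languages accepted by NFAwntl and the class of languages accepted by DFAwntl both properly include the class of regular languages. (2) Each of these two classes is incomparable (with respect to inclusion) to each of the following classes: deterministic linear, 2detLIN, linear context-free, deterministic context-free, and context-free languages. (3) There is a language $L$ over $\{a,b,c,d\}$ that is accepted by a DFAwntl, is not context-free, and satisfies $L\cap a^*d^*c^*b^*=\{a^nd^nc^nb^n\mid n\ge 0\}$; the latter language is not context-free. (4) The language $\{a^nb^n\mid n\ge 0\}$ over $\{a,b\}$ belongs to all five classes listed in (2), it has no letter-equivalent regular sublanguage, and it is not accepted by any NFAwntl. -/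

import Mathlib

/-! ### Classes of formal languages -/

/-- A class of formal languages: a property of languages over arbitrary alphabets. Only finite
alphabets are considered when classes are compared. -/
abbrev LanguageClass : Type 1 := (α : Type) → Language α → Prop

namespace LanguageClass

/-- Every language over a finite alphabet that belongs to `C` belongs to `D`. -/
def Included (C D : LanguageClass) : Prop :=
  ∀ (α : Type) [Finite α] (L : Language α), C α L → D α L

/-- `C` is a proper subclass of `D`. -/
def ProperlyIncluded (C D : LanguageClass) : Prop :=
  C.Included D ∧ ¬ D.Included C

/-- Neither of the two classes is included in the other one. -/
def Incomparable (C D : LanguageClass) : Prop :=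
  ¬ C.Included D ∧ ¬ D.Included C

end LanguageClass

/-! ### Finite automata with nondeterministically translucent letters -/

/-- A finite automaton with nondeterministically translucent letters, with set of states `σ`
over the alphabet `α`. The endmarker is implicit: it is the end of the list. No disjointness
between translucent letters and readable letters of a state is required. -/
structure NFAwntl (α σ : Type) where
  /-- The translucency mapping. -/
  translucent : σ → Set α
  /-- The set of initial states. -/
  start : Set σ
  /-- The set of final states. -/
  accept : Set σ
  /-- The transition relation. -/
  step : σ → α → Set σ

namespace NFAwntl

variable {α σ : Type}

/-- One computation step `q · u b v ⊢ p · u v`, where all letters of `u` are translucent for `q`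
and `p ∈ δ(q, b)`. -/
inductive Move (M : NFAwntl α σ) : σ × List α → σ × List α → Prop
  | erase {q p : σ} {u v : List α} {b : α} (hu : ∀ x ∈ u, x ∈ M.translucent q)
      (hp : p ∈ M.step q b) : Move M (q, u ++ b :: v) (p, u ++ v)

/-- A word is accepted if from some initial state one can reach a configuration with a final state
all of whose remaining letters are translucent for that state. -/
def accepts (M : NFAwntl α σ) : Language α :=
  {w | ∃ q₀ ∈ M.start, ∃ q ∈ M.accept, ∃ r : List α,
    Relation.ReflTransGen M.Move (q₀, w) (q, r) ∧ ∀ x ∈ r, x ∈ M.translucent q}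

/-- Exactly one initial state and at most one transition for each state and letter. -/
def IsDeterministic (M : NFAwntl α σ) : Prop :=
  (∃ q₀, M.start = {q₀}) ∧ ∀ q a, (M.step q a).Subsingleton

end NFAwntl

/-! ### Deterministic pushdown automata -/

/-- A deterministic pushdown automaton with states `σ` and stack alphabet `Γ`. A transition
`δ(q, a, Z) = (p, γ)` (where `a` is a letter or `none`, for the empty word) replaces the topmost
stack symbol `Z` by the word `γ`, whose first symbol becomes the topmost one. -/
structure DetPDA (α σ Γ : Type) where
  /-- The partial transition function. -/
  step : σ → Option α → Γ → Option (σ × List Γ)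
  /-- The initial state. -/
  start : σ
  /-- The initial stack symbol. -/
  bottom : Γ
  /-- The set of final states. -/
  accept : Set σ
  /-- If a move without reading is possible, then no reading move is possible. -/
  det : ∀ q Z, step q none Z ≠ none → ∀ a, step q (some a) Z = none

namespace DetPDA

variable {α σ Γ : Type}

/-- One move between configurations (state, remaining input, stack). -/
inductive Move (M : DetPDA α σ Γ) :
    σ × List α × List Γ → σ × List α × List Γ → Prop
  | read {q p : σ} {a : α} {w : List α} {Z : Γ} {γ s : List Γ}
      (h : M.step q (some a) Z = some (p, γ)) : Move M (q, a :: w, Z :: s) (p, w, γ ++ s)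
  | empty {q p : σ} {w : List α} {Z : Γ} {γ s : List Γ}
      (h : M.step q none Z = some (p, γ)) : Move M (q, w, Z :: s) (p, w, γ ++ s)

/-- Reachability between configurations. -/
def Reaches (M : DetPDA α σ Γ) :
    σ × List α × List Γ → σ × List α × List Γ → Prop :=
  Relation.ReflTransGen M.Move

/-- Acceptance by final state after the whole input has been read. -/
def accepts (M : DetPDA α σ Γ) : Language α :=
  {w | ∃ f ∈ M.accept, ∃ s : List Γ, M.Reaches (M.start, w, [M.bottom]) (f, [], s)}

/-- In every computation, after a move that decreases the height of the stack there is no move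
that increases the height of the stack. -/
def IsOneTurn (M : DetPDA α σ Γ) : Prop :=
  ∀ (w : List α) (c₁ c₂ c₃ c₄ : σ × List α × List Γ),
    M.Reaches (M.start, w, [M.bottom]) c₁ → M.Move c₁ c₂ →
    c₂.2.2.length < c₁.2.2.length →
    M.Reaches c₂ c₃ → M.Move c₃ c₄ → c₄.2.2.length ≤ c₃.2.2.length

end DetPDA

/-! ### Two-head automata reading the input from its two ends -/

/-- A sensing `5' → 3'` Watson–Crick finite automaton, that is, a finite automaton whose two heads
read the input from its two extremes until they meet. The transition `(q, u, v, p)` leads from `q`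
to `p`; the left head reads the prefix `u`, the right head the suffix `v` of the unread input. -/
structure TwoHeadFA (α σ : Type) where
  /-- The finitely many transitions. -/
  trans : Finset (σ × List α × List α × σ)
  /-- The initial state. -/
  start : σ
  /-- The set of final states. -/
  accept : Set σ

namespace TwoHeadFA

variable {α σ : Type}

/-- One computation step; a configuration consists of a state and the unread part of the input. -/
inductive Move (M : TwoHeadFA α σ) : σ × List α → σ × List α → Prop
  | read {q p : σ} {u v w : List α} (h : (q, u, v, p) ∈ M.trans) :
      Move M (q, u ++ w ++ v) (p, w)

/-- A word is accepted if it can be read completely so that a final state is reached. -/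
def accepts (M : TwoHeadFA α σ) : Language α :=
  {w | ∃ f ∈ M.accept, Relation.ReflTransGen M.Move (M.start, w) (f, [])}

/-- Every configuration has at most one next configuration. -/
def IsDeterministic (M : TwoHeadFA α σ) : Prop :=
  ∀ c c₁ c₂, M.Move c c₁ → M.Move c c₂ → c₁ = c₂

end TwoHeadFA

/-! ### Linear grammars -/

/-- The right-hand side of each rule contains at most one nonterminal. -/
def ContextFreeGrammar.IsLinear {α : Type} (g : ContextFreeGrammar α) : Prop :=
  ∀ r ∈ g.rules,
    (∃ u : List α, r.output = u.map Symbol.terminal) ∨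
    (∃ (u v : List α) (A : g.NT),
      r.output = u.map Symbol.terminal ++ [Symbol.nonterminal A] ++ v.map Symbol.terminal)

/-! ### The language classes -/

namespace LanguageClass

/-- Languages accepted by NFAwntl. -/
def nfaWNTL : LanguageClass := fun α L =>
  ∃ (σ : Type) (_ : Fintype σ) (M : NFAwntl α σ), M.accepts = L

/-- Languages accepted by DFAwntl. -/
def dfaWNTL : LanguageClass := fun α L =>
  ∃ (σ : Type) (_ : Fintype σ) (M : NFAwntl α σ), M.IsDeterministic ∧ M.accepts = L

/-- Regular languages. -/
def regular : LanguageClass := fun _ L => L.IsRegular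

/-- Context-free languages. -/
def contextFree : LanguageClass := fun _ L => L.IsContextFree

/-- Linear context-free languages. -/
def linear : LanguageClass := fun α L =>
  ∃ g : ContextFreeGrammar α, g.IsLinear ∧ g.language = L

/-- Deterministic context-free languages. -/
def detContextFree : LanguageClass := fun α L =>
  ∃ (σ Γ : Type) (_ : Fintype σ) (_ : Fintype Γ) (M : DetPDA α σ Γ), M.accepts = L

/-- Deterministic linear languages: those accepted by deterministic one-turn pushdown automata. -/
def detLinear : LanguageClass := fun α L =>
  ∃ (σ Γ : Type) (_ : Fintype σ) (_ : Fintype Γ) (M : DetPDA α σ Γ),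
    M.IsOneTurn ∧ M.accepts = L

/-- 2detLIN: languages accepted by deterministic `5' → 3'` Watson–Crick finite automata. -/
def twoDetLIN : LanguageClass := fun α L =>
  ∃ (σ : Type) (_ : Fintype σ) (M : TwoHeadFA α σ), M.IsDeterministic ∧ M.accepts = L

end LanguageClass

/-! ### Letter equivalence and the witness languages -/

/-- Two languages are letter equivalent if each word of either one is a permutation of some word of
the other one. -/
def LetterEquivalent {α : Type} (L₁ L₂ : Language α) : Prop :=
  (∀ x ∈ L₁, ∃ y ∈ L₂, y.Perm x) ∧ (∀ x ∈ L₂, ∃ y ∈ L₁, y.Perm x)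

/-- The language `{aⁿbⁿ | n ≥ 0}`, with letters `a = 0`, `b = 1`. -/
def langAB : Language (Fin 2) :=
  {w | ∃ n : ℕ, w = List.replicate n 0 ++ List.replicate n 1}

/-- The language `a*d*c*b*`, with letters `a = 0`, `b = 1`, `c = 2`, `d = 3`. -/
def langBlocks : Language (Fin 4) :=
  {w | ∃ i j k l : ℕ, w = List.replicate i 0 ++ List.replicate j 3 ++
    List.replicate k 2 ++ List.replicate l 1}

/-- The language `{aⁿdⁿcⁿbⁿ | n ≥ 0}`, with letters `a = 0`, `b = 1`, `c = 2`, `d = 3`. -/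
def langADCB : Language (Fin 4) :=
  {w | ∃ n : ℕ, w = List.replicate n 0 ++ List.replicate n 3 ++
    List.replicate n 2 ++ List.replicate n 1}

/-!
If a translucent-letter automaton is made to read its input from left to right, it accepts only
words that the automaton accepts anyway; and if the letters of an accepted word are arranged in the
order in which they are erased, the resulting word is read from left to right. So every language of
an NFAwntl has a letter-equivalent regular sublanguage. A sublanguage of `{aⁿbⁿ}` letter equivalent
to it is the whole language, which is not regular; hence no NFAwntl accepts `{aⁿbⁿ}`.

In the other direction, a DFAwntl that erases the letters `a`, `b`, `c`, `d` in turn accepts a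
language that contains `{aⁿdⁿcⁿbⁿ}` and in all of whose words the four letters occur equally often.
No language with these two properties is context-free. Indeed, for large `n` the word `aⁿdⁿcⁿbⁿ` has
a factor that is derived from a single nonterminal and whose length lies between `m` and a constant
multiple of `m`, so that `a` or `b` is missing from it. Letting `m` grow, two such factors `x`, `y`
with `|x| > |y|` are derived from the same nonterminal, and `x` may be substituted for `y`. But this
substitution must change the number of occurrences of every letter by the same amount, which is at
most `0` for the letter missing from `x`, so `x` cannot be longer than `y`.
-/

/-! ### Regular languages -/

theorem not_isRegular_of_fooling {α ι : Type*} [Infinite ι] {L : Language α} (u v : ι → List α)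
    (h : ∀ i j, u i ++ v j ∈ L ↔ i = j) : ¬ L.IsRegular := by
  intro hL
  have hinj : Function.Injective fun i => L.leftQuotient (u i) := fun i j hij => by
    have hj : v j ∈ L.leftQuotient (u j) := (h j j).2 rfl
    rw [← show L.leftQuotient (u i) = L.leftQuotient (u j) from hij] at hj
    exact (h i j).1 hj
  exact Set.infinite_range_of_injective hinj
    (hL.finite_range_leftQuotient.subset (Set.range_comp_subset_range u L.leftQuotient))

namespace NFAwntl

variable {α σ : Type}

/-- The words from which an automaton that is in state `q` can reach acceptance. -/
def acceptsFrom (M : NFAwntl α σ) (q : σ) : Language α :=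
  {w | ∃ f ∈ M.accept, ∃ r : List α,
    Relation.ReflTransGen M.Move (q, w) (f, r) ∧ ∀ x ∈ r, x ∈ M.translucent f}

theorem mem_accepts_iff {M : NFAwntl α σ} {w : List α} :
    w ∈ M.accepts ↔ ∃ q ∈ M.start, w ∈ M.acceptsFrom q :=
  Iff.rfl

theorem mem_acceptsFrom_of_translucent {M : NFAwntl α σ} {q : σ} {w : List α}
    (hq : q ∈ M.accept) (hw : ∀ x ∈ w, x ∈ M.translucent q) : w ∈ M.acceptsFrom q :=
  ⟨q, hq, w, .refl, hw⟩

theorem mem_acceptsFrom_of_move {M : NFAwntl α σ} {q p : σ} {w w' : List α}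
    (h : M.Move (q, w) (p, w')) (hw' : w' ∈ M.acceptsFrom p) : w ∈ M.acceptsFrom q := by
  obtain ⟨f, hf, r, hr, hτ⟩ := hw'
  exact ⟨f, hf, r, .head h hr, hτ⟩

theorem cons_mem_acceptsFrom {M : NFAwntl α σ} {q p : σ} {a : α} {w : List α}
    (hp : p ∈ M.step q a) (hw : w ∈ M.acceptsFrom p) : a :: w ∈ M.acceptsFrom q :=
  mem_acceptsFrom_of_move (.erase (u := []) (by simp) hp) hw

theorem acceptsFrom_induction {M : NFAwntl α σ} {P : σ → List α → Prop}
    (halt : ∀ q ∈ M.accept, ∀ w : List α, (∀ x ∈ w, x ∈ M.translucent q) → P q w)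
    (erase : ∀ q p u v b, (∀ x ∈ u, x ∈ M.translucent q) → p ∈ M.step q b → P p (u ++ v) →
      P q (u ++ b :: v))
    {q : σ} {w : List α} (h : w ∈ M.acceptsFrom q) : P q w := by
  obtain ⟨f, hf, r, hr, hτ⟩ := h
  generalize hc : (q, w) = c at hr
  induction hr using Relation.ReflTransGen.head_induction_on generalizing q w with
  | refl => cases hc; exact halt _ hf _ hτ
  | head hmove _ ih =>
    subst hc
    cases hmove with
    | erase hu hp => exact erase _ _ _ _ _ hu hp (ih rfl)

/-- A deterministic finite automaton, seen as one without translucent letters. -/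
def ofDFA (D : DFA α σ) : NFAwntl α σ where
  translucent _ := ∅
  start := {D.start}
  accept := D.accept
  step q a := {D.step q a}

theorem ofDFA_isDeterministic (D : DFA α σ) : (ofDFA D).IsDeterministic :=
  ⟨⟨D.start, rfl⟩, fun _ _ => Set.subsingleton_singleton⟩

theorem acceptsFrom_ofDFA (D : DFA α σ) (q : σ) : (ofDFA D).acceptsFrom q = D.acceptsFrom q := by
  ext w
  constructor
  · intro h
    refine acceptsFrom_induction (P := fun q w => w ∈ D.acceptsFrom q)
      (fun q hq w hw => ?_) (fun q p u v b hu hp ih => ?_) h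
    · obtain rfl : w = [] := List.eq_nil_iff_forall_not_mem.2 hw
      exact hq
    · obtain rfl : u = [] := List.eq_nil_iff_forall_not_mem.2 hu
      obtain rfl : p = D.step q b := hp
      exact ih
  · intro h
    induction w generalizing q with
    | nil => exact mem_acceptsFrom_of_translucent h (by simp)
    | cons a w ih => exact cons_mem_acceptsFrom rfl (ih _ h)

theorem accepts_ofDFA (D : DFA α σ) : (ofDFA D).accepts = D.accepts := by
  ext w
  simp only [mem_accepts_iff, acceptsFrom_ofDFA]
  exact exists_eq_left

/-- A nondeterministic finite automaton for the words that `M` accepts by a computation that always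
reads the first remaining letter. In state `inl q` the automaton `M` is in state `q`; in state
`inr q` it has halted in state `q`, and the remaining letters are checked to be translucent. -/
def leftToRight (M : NFAwntl α σ) : NFA α (σ ⊕ σ) where
  step
    | .inl q, a => Sum.inl '' M.step q a ∪ {s | s = .inr q ∧ a ∈ M.translucent q}
    | .inr q, a => {s | s = .inr q ∧ a ∈ M.translucent q}
  start := Sum.inl '' M.start
  accept := Sum.elim id id ⁻¹' M.accept

variable {M : NFAwntl α σ}

theorem mem_acceptsFrom_of_leftToRight_path {s t : σ ⊕ σ} {w : List α}
    (h : M.leftToRight.Path s t w) (ht : t ∈ M.leftToRight.accept) :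
    Sum.elim (fun q => w ∈ M.acceptsFrom q)
      (fun q => q ∈ M.accept ∧ ∀ x ∈ w, x ∈ M.translucent q) s := by
  induction h with
  | nil s =>
    cases s with
    | inl q => exact mem_acceptsFrom_of_translucent ht (by simp)
    | inr q => exact ⟨ht, by simp⟩
  | cons s' s t a w hs _ ih =>
    cases s with
    | inl q =>
      rcases hs with ⟨p, hp, rfl⟩ | ⟨rfl, ha⟩
      · exact cons_mem_acceptsFrom hp (ih ht)
      · exact mem_acceptsFrom_of_translucent (ih ht).1 (List.forall_mem_cons.2 ⟨ha, (ih ht).2⟩)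
    | inr q =>
      obtain ⟨rfl, ha⟩ := hs
      exact ⟨(ih ht).1, List.forall_mem_cons.2 ⟨ha, (ih ht).2⟩⟩

theorem leftToRight_accepts_le : M.leftToRight.accepts ≤ M.accepts := by
  intro w hw
  obtain ⟨_, ⟨q, hq, rfl⟩, t, ht, ⟨path⟩⟩ := NFA.accepts_iff_exists_path.1 hw
  exact ⟨q, hq, mem_acceptsFrom_of_leftToRight_path path ht⟩

theorem nonempty_leftToRight_path_of_translucent {q : σ} {w : List α}
    (hw : ∀ x ∈ w, x ∈ M.translucent q) :
    Nonempty (M.leftToRight.Path (.inr q) (.inr q) w) := by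
  induction w with
  | nil => exact ⟨.nil _⟩
  | cons a w ih =>
    obtain ⟨ha, hw⟩ := List.forall_mem_cons.1 hw
    obtain ⟨path⟩ := ih hw
    exact ⟨.cons (.inr q) _ _ a w ⟨rfl, ha⟩ path⟩

theorem exists_perm_leftToRight_path {q : σ} {w : List α} (h : w ∈ M.acceptsFrom q) :
    ∃ y, y.Perm w ∧ ∃ t ∈ M.leftToRight.accept, Nonempty (M.leftToRight.Path (.inl q) t y) := by
  refine acceptsFrom_induction (P := fun q w => ∃ y, y.Perm w ∧
    ∃ t ∈ M.leftToRight.accept, Nonempty (M.leftToRight.Path (.inl q) t y))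
    (fun q hq w hw => ⟨w, .refl w, ?_⟩) (fun q p u v b _ hp ih => ?_) h
  · cases w with
    | nil => exact ⟨.inl q, hq, ⟨.nil _⟩⟩
    | cons a w =>
      obtain ⟨ha, hw⟩ := List.forall_mem_cons.1 hw
      obtain ⟨path⟩ := nonempty_leftToRight_path_of_translucent hw
      exact ⟨.inr q, hq, ⟨.cons (.inr q) _ _ a w (.inr ⟨rfl, ha⟩) path⟩⟩
  · obtain ⟨y, hy, t, ht, ⟨path⟩⟩ := ih
    exact ⟨b :: y, (hy.cons b).trans List.perm_middle.symm, t, ht,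
      ⟨.cons (.inl p) _ _ b y (.inl ⟨p, hp, rfl⟩) path⟩⟩

theorem exists_isRegular_letterEquivalent [Finite σ] (M : NFAwntl α σ) :
    ∃ R : Language α, R ≤ M.accepts ∧ R.IsRegular ∧ LetterEquivalent R M.accepts := by
  have := Fintype.ofFinite σ
  refine ⟨M.leftToRight.accepts, leftToRight_accepts_le,
    ⟨Set (σ ⊕ σ), inferInstance, M.leftToRight.toDFA, NFA.toDFA_correct⟩,
    fun x hx => ⟨x, leftToRight_accepts_le hx, .refl x⟩, ?_⟩
  rintro w ⟨q, hq, hw⟩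
  obtain ⟨y, hy, t, ht, path⟩ := exists_perm_leftToRight_path hw
  exact ⟨y, NFA.accepts_iff_exists_path.2 ⟨_, ⟨q, hq, rfl⟩, t, ht, path⟩, hy⟩

end NFAwntl

/-! ### Context-free grammars -/

section Grammar

open Symbol

variable {α : Type*} {N : Type*}

/-- The value of a sentential form when the nonterminal `A` stands for the language `I A` and
juxtaposition for concatenation. -/
def formLanguage (I : N → Language α) (s : List (Symbol α N)) : Language α :=
  (s.map fun
    | terminal a => {[a]}
    | nonterminal A => I A).prod

theorem formLanguage_append (I : N → Language α) (s t : List (Symbol α N)) :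
    formLanguage I (s ++ t) = formLanguage I s * formLanguage I t := by
  simp only [formLanguage, List.map_append, List.prod_append]

theorem formLanguage_terminal_cons (I : N → Language α) (a : α) (s : List (Symbol α N)) :
    formLanguage I (terminal a :: s) = {[a]} * formLanguage I s :=
  List.prod_cons

theorem formLanguage_nonterminal (I : N → Language α) (A : N) :
    formLanguage I [nonterminal A] = I A :=
  List.prod_singleton

theorem formLanguage_map_terminal (I : N → Language α) (w : List α) :
    formLanguage I (w.map terminal) = {w} := by
  induction w with
  | nil => rfl
  | cons a w ih =>
    rw [List.map_cons, formLanguage_terminal_cons, ih]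
    exact Set.image2_singleton

theorem formLanguage_map_nonterminal (I : N → Language α) (l : List N) :
    formLanguage I (l.map nonterminal) = (l.map I).prod := by
  rw [formLanguage, List.map_map]
  rfl

variable {g : ContextFreeGrammar α}

theorem formLanguage_le_of_produces {I : g.NT → Language α}
    (hI : ∀ r ∈ g.rules, formLanguage I r.output ≤ I r.input) {s t : List (Symbol α g.NT)}
    (h : g.Produces s t) : formLanguage I t ≤ formLanguage I s := by
  obtain ⟨r, hr, hst⟩ := h
  obtain ⟨p, q, rfl, rfl⟩ := hst.exists_parts
  simp only [formLanguage_append, formLanguage_nonterminal]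
  gcongr
  exact hI r hr

theorem formLanguage_le_of_derives {I : g.NT → Language α}
    (hI : ∀ r ∈ g.rules, formLanguage I r.output ≤ I r.input) {s t : List (Symbol α g.NT)}
    (h : g.Derives s t) : formLanguage I t ≤ formLanguage I s := by
  induction h with
  | refl => exact le_rfl
  | tail _ h ih => exact (formLanguage_le_of_produces hI h).trans ih

/-- The language generated from the nonterminal `A`. -/
def nonterminalLanguage (g : ContextFreeGrammar α) (A : g.NT) : Language α :=
  {w | g.Derives [nonterminal A] (w.map terminal)}

theorem mem_nonterminalLanguage {A : g.NT} {w : List α} :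
    w ∈ nonterminalLanguage g A ↔ g.Derives [nonterminal A] (w.map terminal) :=
  Iff.rfl

/-- One half of the theorem of Ginsburg and Rice: a grammar generates the least solution of its
rules, read as a system of inequalities between languages. -/
theorem nonterminalLanguage_le {I : g.NT → Language α}
    (hI : ∀ r ∈ g.rules, formLanguage I r.output ≤ I r.input) (A : g.NT) :
    nonterminalLanguage g A ≤ I A := by
  intro w hw
  rw [← formLanguage_nonterminal I A]
  apply formLanguage_le_of_derives hI hw
  rw [formLanguage_map_terminal]
  rfl

theorem produces_of_mem_rules {r : ContextFreeRule α g.NT} (hr : r ∈ g.rules) :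
    g.Produces [nonterminal r.input] r.output :=
  ⟨r, hr, .input_output⟩

theorem derives_append {s₁ s₂ t₁ t₂ : List (Symbol α g.NT)} (hs : g.Derives s₁ s₂)
    (ht : g.Derives t₁ t₂) : g.Derives (s₁ ++ t₁) (s₂ ++ t₂) :=
  (hs.append_right t₁).trans (ht.append_left s₂)

/-! ### Interchangeable factors -/

/-- Some derivation of `w` from `s` derives a factor `x` of `w`, with `m ≤ |x| ≤ n`, from a single
occurrence of the left-hand side of a rule. -/
def HasDerivedFactor (g : ContextFreeGrammar α) (m n : ℕ) (s : List (Symbol α g.NT))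
    (w : List α) : Prop :=
  ∃ r ∈ g.rules, ∃ u x v : List α, w = u ++ x ++ v ∧ m ≤ x.length ∧ x.length ≤ n ∧
    x ∈ nonterminalLanguage g r.input ∧
    g.Derives s (u.map terminal ++ [nonterminal r.input] ++ v.map terminal)

variable {m n : ℕ} {s t : List (Symbol α g.NT)} {w z : List α}

theorem HasDerivedFactor.of_derives (hst : g.Derives s t) (h : HasDerivedFactor g m n t w) :
    HasDerivedFactor g m n s w := by
  obtain ⟨r, hr, u, x, v, hw, hm, hn, hx, ht⟩ := h
  exact ⟨r, hr, u, x, v, hw, hm, hn, hx, hst.trans ht⟩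

theorem HasDerivedFactor.append_left (hz : g.Derives t (z.map terminal))
    (h : HasDerivedFactor g m n s w) : HasDerivedFactor g m n (t ++ s) (z ++ w) := by
  obtain ⟨r, hr, u, x, v, rfl, hm, hn, hx, hs⟩ := h
  exact ⟨r, hr, z ++ u, x, v, by simp, hm, hn, hx, by simpa using derives_append hz hs⟩

theorem HasDerivedFactor.append_right (hz : g.Derives t (z.map terminal))
    (h : HasDerivedFactor g m n s w) : HasDerivedFactor g m n (s ++ t) (w ++ z) := by
  obtain ⟨r, hr, u, x, v, rfl, hm, hn, hx, hs⟩ := h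
  exact ⟨r, hr, u, x, v ++ z, by simp, hm, hn, hx, by simpa using derives_append hs hz⟩

/-- The words generated from `A` that, if long enough, have a derived factor of length between `m`
and `n`. -/
def factorLanguage (g : ContextFreeGrammar α) (m n : ℕ) (A : g.NT) : Language α :=
  {w | w ∈ nonterminalLanguage g A ∧ (m ≤ w.length → HasDerivedFactor g m n [nonterminal A] w)}

theorem derives_and_hasDerivedFactor_of_mem_formLanguage (hm : 0 < m)
    (hw : w ∈ formLanguage (factorLanguage g m n) s) :
    g.Derives s (w.map terminal) ∧ (s.length * m < w.length → HasDerivedFactor g m n s w) := by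
  induction s generalizing w with
  | nil =>
    obtain rfl : w = [] := hw
    exact ⟨.refl _, fun h => by simp at h⟩
  | cons X s ih =>
    obtain ⟨x, hx, y, hy, rfl⟩ : ∃ x ∈ formLanguage (factorLanguage g m n) [X],
        ∃ y ∈ formLanguage (factorLanguage g m n) s, x ++ y = w := by
      rwa [← Language.mem_mul, ← formLanguage_append]
    obtain ⟨hsy, hfactor⟩ := ih hy
    obtain ⟨hXx, hxfactor⟩ : g.Derives [X] (x.map terminal) ∧
        (m < x.length → HasDerivedFactor g m n [X] x) := by
      cases X with
      | terminal a =>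
        obtain rfl : x = [a] := (formLanguage_map_terminal _ [a]).le hx
        exact ⟨.refl _, fun h => absurd h (Nat.not_lt.2 hm)⟩
      | nonterminal A =>
        rw [formLanguage_nonterminal] at hx
        exact ⟨hx.1, fun h => hx.2 h.le⟩
    refine ⟨by simpa using derives_append hXx hsy, fun hlong => ?_⟩
    by_cases hxlong : m < x.length
    · exact (hxfactor hxlong).append_right hsy
    · refine (hfactor ?_).append_left hXx
      simp only [List.length_cons, List.length_append, add_mul, one_mul] at hlong
      omega

theorem hasDerivedFactor_of_mem_nonterminalLanguage (hm : 0 < m) {A : g.NT}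
    (hw : w ∈ nonterminalLanguage g A) (hmw : m ≤ w.length) :
    HasDerivedFactor g m (g.rules.sup (fun r => r.output.length) * m) [nonterminal A] w := by
  refine (nonterminalLanguage_le (I := factorLanguage g m _) (fun r hr w hw => ?_) A hw).2 hmw
  have hproduces := produces_of_mem_rules hr
  obtain ⟨hderives, hfactor⟩ := derives_and_hasDerivedFactor_of_mem_formLanguage hm hw
  have hrw : w ∈ nonterminalLanguage g r.input := hproduces.trans_derives hderives
  refine ⟨hrw, fun hmw => ?_⟩
  by_cases hlong : r.output.length * m < w.length
  · exact (hfactor hlong).of_derives hproduces.single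
  · have hsup : r.output.length ≤ g.rules.sup fun r => r.output.length :=
      Finset.le_sup (f := fun r : ContextFreeRule α g.NT => r.output.length) hr
    exact ⟨r, hr, [], w, [], by simp, hmw, (not_lt.1 hlong).trans (Nat.mul_le_mul_right m hsup),
      hrw, .refl _⟩

/-- A weak form of the interchange lemma of Ogden, Ross and Winklmann. -/
theorem exists_interchangeable_factors {L : Language α} (hL : L.IsContextFree) :
    ∃ 𝓕 : Set (Language α), 𝓕.Finite ∧ ∃ K : ℕ, ∀ m, 0 < m → ∀ w ∈ L, m ≤ w.length →
      ∃ F ∈ 𝓕, ∃ u x v : List α, w = u ++ x ++ v ∧ m ≤ x.length ∧ x.length ≤ K * m ∧ x ∈ F ∧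
        ∀ y ∈ F, u ++ y ++ v ∈ L := by
  obtain ⟨g, rfl⟩ := hL
  refine ⟨(fun r : ContextFreeRule α g.NT => nonterminalLanguage g r.input) '' g.rules,
    g.rules.finite_toSet.image _, g.rules.sup fun r => r.output.length, fun m hm w hw hmw => ?_⟩
  obtain ⟨r, hr, u, x, v, rfl, hmx, hxn, hx, hderives⟩ :=
    hasDerivedFactor_of_mem_nonterminalLanguage hm hw hmw
  refine ⟨_, ⟨r, hr, rfl⟩, u, x, v, rfl, hmx, hxn, hx, fun y hy => ?_⟩
  have hword := ((mem_nonterminalLanguage.1 hy).append_left (u.map terminal)).append_right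
    (v.map terminal)
  rw [← List.map_append, ← List.map_append] at hword
  exact hderives.trans hword

end Grammar

/-! ### Balanced languages -/

/-- All letters occur equally often in every word of the language. -/
def IsBalanced {α : Type*} [DecidableEq α] (L : Language α) : Prop :=
  ∀ w ∈ L, ∀ a b, w.count a = w.count b

theorem IsBalanced.mono {α : Type*} [DecidableEq α] {L L' : Language α} (h : IsBalanced L')
    (hle : L ≤ L') : IsBalanced L :=
  fun w hw => h w (hle hw)

/-- If `x` misses a letter, then exchanging a factor `y` for `x` within a balanced language removes
equally many occurrences of each letter. -/
theorem IsBalanced.length_le_of_interchange {α : Type*} [DecidableEq α] {L : Language α}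
    (hL : IsBalanced L) {u x y v : List α} (hy : u ++ y ++ v ∈ L) (hx : u ++ x ++ v ∈ L) {a : α}
    (ha : a ∉ x) : x.length ≤ y.length := by
  refine (List.subperm_ext_iff.2 fun b _ => ?_).length_le
  have hycount := hL _ hy b a
  have hxcount := hL _ hx b a
  simp only [List.count_append, List.count_eq_zero.2 ha] at hycount hxcount
  omega

theorem IsBalanced.not_isContextFree {α : Type*} [DecidableEq α] {L : Language α}
    (hL : IsBalanced L)
    (hlong : ∀ n : ℕ, ∃ w ∈ L, n ≤ w.length ∧ ∀ x, x <:+: w → x.length ≤ n → ∃ a, a ∉ x) :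
    ¬ L.IsContextFree := by
  intro hcf
  obtain ⟨𝓕, hfin, K, hfactor⟩ := exists_interchangeable_factors hcf
  have hmissing : ∀ m : ℕ, ∃ F : 𝓕, ∃ u x v : List α, u ++ x ++ v ∈ L ∧ m < x.length ∧
      x.length ≤ K * (m + 1) ∧ x ∈ F.1 ∧ (∀ y ∈ F.1, u ++ y ++ v ∈ L) ∧ ∃ a, a ∉ x := by
    intro m
    obtain ⟨w, hw, hlength, hmiss⟩ := hlong (K * (m + 1) + (m + 1))
    obtain ⟨F, hF, u, x, v, rfl, hmx, hxK, hx, hswap⟩ :=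
      hfactor (m + 1) m.succ_pos w hw (le_of_add_le_right hlength)
    exact ⟨⟨F, hF⟩, u, x, v, hw, hmx, hxK, hx, hswap,
      hmiss x ⟨u, v, rfl⟩ (hxK.trans (Nat.le_add_right _ _))⟩
  choose F u x v hmem hmx hxK hx hswap hmiss using hmissing
  have := hfin.to_subtype
  obtain ⟨F₀, hF₀⟩ := Finite.exists_infinite_fiber F
  have hinfinite : (F ⁻¹' {F₀}).Infinite := Set.infinite_coe_iff.1 hF₀
  obtain ⟨k, hk : F k = F₀⟩ := hinfinite.nonempty
  obtain ⟨m, hm : F m = F₀, hkm⟩ := hinfinite.exists_gt (K * (k + 1))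
  obtain ⟨a, ha⟩ := hmiss m
  have hshort : (x m).length ≤ (x k).length :=
    hL.length_le_of_interchange (hmem k) (hswap k _ (hk ▸ hm ▸ hx m)) ha
  exact absurd (hmx m) (by have := hxK k; omega)

/-! ### Linear grammars of two-head automata -/

namespace TwoHeadFA

open Symbol

variable {α σ : Type}

/-- The words that can be read completely from the state `q` so that a final state is reached. -/
def acceptsFrom (M : TwoHeadFA α σ) (q : σ) : Language α :=
  {w | ∃ f ∈ M.accept, Relation.ReflTransGen M.Move (q, w) (f, [])}

open Classical in
/-- The linear grammar of a two-head automaton. The states are its nonterminals, and each transition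
`(q, u, v, p)` becomes the rule `q → u p v`. -/
noncomputable abbrev toLinearGrammar [Finite σ] (M : TwoHeadFA α σ) : ContextFreeGrammar α where
  NT := σ
  initial := M.start
  rules := M.trans.image (fun t => ⟨t.1, t.2.1.map terminal ++ [nonterminal t.2.2.2] ++
      t.2.2.1.map terminal⟩) ∪ M.accept.toFinite.toFinset.image (fun f => ⟨f, []⟩)

variable [Finite σ] {M : TwoHeadFA α σ}

theorem mem_toLinearGrammar_rules {r : ContextFreeRule α σ} :
    r ∈ M.toLinearGrammar.rules ↔
      (∃ q u v p, (q, u, v, p) ∈ M.trans ∧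
        r = ⟨q, u.map terminal ++ [nonterminal p] ++ v.map terminal⟩) ∨
      ∃ f ∈ M.accept, r = ⟨f, []⟩ := by
  simp [eq_comm]

theorem isLinear_toLinearGrammar : M.toLinearGrammar.IsLinear := by
  intro r hr
  rcases mem_toLinearGrammar_rules.1 hr with ⟨q, u, v, p, _, rfl⟩ | ⟨f, _, rfl⟩
  · exact .inr ⟨u, v, p, rfl⟩
  · exact .inl ⟨[], rfl⟩

theorem nonterminalLanguage_toLinearGrammar_le (q : σ) :
    nonterminalLanguage M.toLinearGrammar q ≤ M.acceptsFrom q := by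
  refine nonterminalLanguage_le (g := M.toLinearGrammar) (I := M.acceptsFrom) (fun r hr => ?_) q
  rcases mem_toLinearGrammar_rules.1 hr with ⟨q, u, v, p, ht, rfl⟩ | ⟨f, hf, rfl⟩
  · rw [formLanguage_append, formLanguage_append, formLanguage_map_terminal,
      formLanguage_map_terminal, formLanguage_nonterminal]
    rintro _ ⟨_, ⟨_, rfl, w, ⟨f, hf, hw⟩, rfl⟩, _, rfl, rfl⟩
    exact ⟨f, hf, .head (.read ht) hw⟩
  · rintro _ rfl
    exact ⟨f, hf, .refl⟩

theorem le_nonterminalLanguage_toLinearGrammar (q : σ) :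
    M.acceptsFrom q ≤ nonterminalLanguage M.toLinearGrammar q := by
  rintro w ⟨f, hf, h⟩
  generalize hc : (q, w) = c at h
  induction h using Relation.ReflTransGen.head_induction_on generalizing q w with
  | refl =>
    cases hc
    exact (produces_of_mem_rules (mem_toLinearGrammar_rules.2 (.inr ⟨f, hf, rfl⟩))).single
  | head hmove _ ih =>
    subst hc
    cases hmove with
    | @read _ p u v w ht =>
      have hrule := mem_toLinearGrammar_rules.2 (.inl ⟨q, u, v, p, ht, rfl⟩)
      have hw := ((ih p rfl).append_left (u.map terminal)).append_right (v.map terminal)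
      rw [← List.map_append, ← List.map_append] at hw
      exact (produces_of_mem_rules hrule).trans_derives hw

theorem language_toLinearGrammar : M.toLinearGrammar.language = M.accepts :=
  le_antisymm (nonterminalLanguage_toLinearGrammar_le M.start)
    (le_nonterminalLanguage_toLinearGrammar M.start)

end TwoHeadFA

namespace LanguageClass

theorem twoDetLIN_included_linear : twoDetLIN.Included linear := by
  rintro α _ _ ⟨σ, _, M, _, rfl⟩
  exact ⟨M.toLinearGrammar, TwoHeadFA.isLinear_toLinearGrammar, TwoHeadFA.language_toLinearGrammar⟩

theorem linear_included_contextFree : linear.Included contextFree :=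
  fun _ _ _ ⟨g, _, hg⟩ => ⟨g, hg⟩

end LanguageClass

/-! ### The triple construction for pushdown automata -/

theorem finite_setOf_output_length_le {α N : Type*} [Finite α] [Finite N] (k : ℕ) :
    {r : ContextFreeRule α N | r.output.length ≤ k}.Finite := by
  have := Fintype.ofFinite α
  have := Fintype.ofFinite N
  have hinj : Function.Injective fun r : ContextFreeRule α N => (r.input, r.output) := by
    rintro ⟨A, s⟩ ⟨B, t⟩ h
    simpa using h
  exact ((Set.finite_univ.prod (List.finite_length_le (Symbol α N) k)).preimage hinj.injOn).subset
    fun r hr => ⟨Set.mem_univ _, hr⟩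

namespace DetPDA

open Symbol

variable {α σ Γ : Type} {M : DetPDA α σ Γ}

theorem move_of_step {q p : σ} {o : Option α} {Z : Γ} {γ : List Γ}
    (h : M.step q o Z = some (p, γ)) (w : List α) (s : List Γ) :
    M.Move (q, o.toList ++ w, Z :: s) (p, w, γ ++ s) := by
  cases o with
  | none => exact .empty h
  | some a => exact .read h

theorem exists_step_of_move {c c' : σ × List α × List Γ} (h : M.Move c c') :
    ∃ q o Z p γ w s, M.step q o Z = some (p, γ) ∧ c = (q, o.toList ++ w, Z :: s) ∧
      c' = (p, w, γ ++ s) := by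
  cases h with
  | read h => exact ⟨_, _, _, _, _, _, _, h, rfl, rfl⟩
  | empty h => exact ⟨_, _, _, _, _, _, _, h, rfl, rfl⟩

/-- The words from which an automaton that is in state `q`, with stack `s`, can reach acceptance. -/
def acceptsFrom (M : DetPDA α σ Γ) (q : σ) (s : List Γ) : Language α :=
  {w | ∃ f ∈ M.accept, ∃ s', M.Reaches (q, w, s) (f, [], s')}

theorem mem_acceptsFrom_iff {q : σ} {s : List Γ} {w : List α} :
    w ∈ M.acceptsFrom q s ↔ q ∈ M.accept ∧ w = [] ∨
      ∃ o Z p γ w' s', M.step q o Z = some (p, γ) ∧ w = o.toList ++ w' ∧ s = Z :: s' ∧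
        w' ∈ M.acceptsFrom p (γ ++ s') := by
  constructor
  · rintro ⟨f, hf, s'', h⟩
    rcases h.cases_head with heq | ⟨c, hmove, hc⟩
    · cases heq
      exact .inl ⟨hf, rfl⟩
    · obtain ⟨q, o, Z, p, γ, w, s, hstep, heq, rfl⟩ := exists_step_of_move hmove
      cases heq
      exact .inr ⟨o, Z, p, γ, w, s, hstep, rfl, rfl, f, hf, s'', hc⟩
  · rintro (⟨hq, rfl⟩ | ⟨o, Z, p, γ, w, s, hstep, rfl, rfl, f, hf, s'', h⟩)
    · exact ⟨q, hq, s, .refl⟩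
    · exact ⟨f, hf, s'', .head (move_of_step hstep w s) h⟩

theorem acceptsFrom_induction {P : σ → List Γ → List α → Prop}
    (halt : ∀ q ∈ M.accept, ∀ s, P q s [])
    (step : ∀ q o Z p γ s w, M.step q o Z = some (p, γ) → P p (γ ++ s) w →
      P q (Z :: s) (o.toList ++ w))
    {q : σ} {s : List Γ} {w : List α} (h : w ∈ M.acceptsFrom q s) : P q s w := by
  obtain ⟨f, hf, s', h⟩ := h
  generalize hc : (q, w, s) = c at h
  induction h using Relation.ReflTransGen.head_induction_on generalizing q w s with
  | refl => cases hc; exact halt _ hf _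
  | head hmove _ ih =>
    obtain ⟨q, o, Z, p, γ, w, s, hstep, rfl, rfl⟩ := exists_step_of_move hmove
    cases hc
    exact step _ _ _ _ _ _ _ hstep (ih rfl)

/-- For `t = some p`, the words that can be read from state `q` while emptying the stack `s` and
ending in state `p`; for `t = none`, those that can be read from state `q` with stack `s` while
ending in a final state. The unread input and the stack below `s` are arbitrary. -/
def stackLanguage (M : DetPDA α σ Γ) (q : σ) (s : List Γ) : Option σ → Language α
  | some p => {w | ∀ z s', M.Reaches (q, w ++ z, s ++ s') (p, z, s')}
  | none => {w | ∀ z s', ∃ f ∈ M.accept, ∃ s'', M.Reaches (q, w ++ z, s ++ s') (f, z, s'')}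

theorem append_mem_stackLanguage {q p : σ} {x y : List α} {s s' : List Γ} {t : Option σ}
    (hx : ∀ z s'', M.Reaches (q, x ++ z, s ++ s'') (p, z, s' ++ s''))
    (hy : y ∈ M.stackLanguage p s' t) : x ++ y ∈ M.stackLanguage q s t := by
  cases t with
  | some r =>
    intro z s''
    rw [List.append_assoc]
    exact (hx _ _).trans (hy z s'')
  | none =>
    intro z s''
    obtain ⟨f, hf, s₁, h⟩ := hy z s''
    rw [List.append_assoc]
    exact ⟨f, hf, s₁, (hx _ _).trans h⟩

/-- A triple `(q, Z, t)` stands for the words in `M.stackLanguage q [Z] t`. -/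
abbrev Triple (σ Γ : Type) : Type := σ × Γ × Option σ

/-- `M.Chain q s t l` says that the list `l` of triples describes a computation from state `q`
on the stack `s`: each triple removes the topmost symbol, and the last one may instead end the
computation in a final state. The meaning of `t` is the same as in `M.stackLanguage q s t`. -/
inductive Chain (M : DetPDA α σ Γ) : σ → List Γ → Option σ → List (Triple σ Γ) → Prop
  | done (q : σ) : Chain M q [] (some q) []
  | halt {q : σ} (hq : q ∈ M.accept) (s : List Γ) : Chain M q s none []
  | last (q : σ) (Z : Γ) (s : List Γ) : Chain M q (Z :: s) none [(q, Z, none)]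
  | pop (q : σ) (Z : Γ) {r : σ} {s : List Γ} {t : Option σ} {l : List (Triple σ Γ)}
      (h : Chain M r s t l) : Chain M q (Z :: s) t ((q, Z, some r) :: l)

theorem Chain.length_le {q : σ} {s : List Γ} {t : Option σ} {l : List (Triple σ Γ)}
    (h : M.Chain q s t l) : l.length ≤ s.length := by
  induction h with
  | done | halt => exact Nat.zero_le _
  | last => exact Nat.succ_le_succ (Nat.zero_le _)
  | pop _ _ _ ih => exact Nat.succ_le_succ ih

theorem Chain.prod_le_stackLanguage {q : σ} {s : List Γ} {t : Option σ} {l : List (Triple σ Γ)}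
    (h : M.Chain q s t l) :
    (l.map fun X => M.stackLanguage X.1 [X.2.1] X.2.2).prod ≤ M.stackLanguage q s t := by
  induction h with
  | done q =>
    rintro _ rfl z s'
    exact .refl
  | halt hq s =>
    rintro _ rfl z s'
    exact ⟨_, hq, _, .refl⟩
  | last q Z s =>
    rw [List.map_singleton, List.prod_singleton]
    exact fun w hw z s' => hw z (s ++ s')
  | @pop q Z r s t l _ ih =>
    rw [List.map_cons, List.prod_cons]
    rintro _ ⟨x, hx, y, hy, rfl⟩
    exact append_mem_stackLanguage (fun z s'' => hx z (s ++ s'')) (ih hy)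

theorem Chain.of_append {q : σ} {s s' : List Γ} {t : Option σ} {l : List (Triple σ Γ)}
    (h : M.Chain q (s ++ s') t l) :
    (∃ l₁ r l₂, l = l₁ ++ l₂ ∧ M.Chain q s (some r) l₁ ∧ M.Chain r s' t l₂) ∨
      t = none ∧ M.Chain q s none l := by
  induction s generalizing q l with
  | nil => exact .inl ⟨[], q, l, rfl, .done q, h⟩
  | cons Z s ih =>
    cases h with
    | halt hq => exact .inr ⟨rfl, .halt hq _⟩
    | last => exact .inr ⟨rfl, .last q Z s⟩
    | pop _ _ h =>
      rcases ih h with ⟨l₁, r, l₂, rfl, h₁, h₂⟩ | ⟨ht, h⟩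
      · exact .inl ⟨_, r, l₂, rfl, h₁.pop q Z, h₂⟩
      · exact .inr ⟨ht, h.pop q Z⟩

/-- The rules of the triple construction. -/
inductive IsTripleRule (M : DetPDA α σ Γ) : ContextFreeRule α (Triple σ Γ) → Prop
  | accept {q : σ} (hq : q ∈ M.accept) (Z : Γ) : IsTripleRule M ⟨(q, Z, none), []⟩
  | step {q p : σ} {o : Option α} {Z : Γ} {γ : List Γ} {t : Option σ} {l : List (Triple σ Γ)}
      (hstep : M.step q o Z = some (p, γ)) (hl : M.Chain p γ t l) :
      IsTripleRule M ⟨(q, Z, t), o.toList.map terminal ++ l.map nonterminal⟩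

theorem formLanguage_le_of_isTripleRule {r : ContextFreeRule α (Triple σ Γ)}
    (hr : M.IsTripleRule r) :
    formLanguage (fun X : Triple σ Γ => M.stackLanguage X.1 [X.2.1] X.2.2) r.output ≤
      M.stackLanguage r.input.1 [r.input.2.1] r.input.2.2 := by
  cases hr with
  | accept hq Z =>
    rintro _ rfl z s'
    exact ⟨_, hq, _, .refl⟩
  | @step q p o Z γ t l hstep hl =>
    rw [formLanguage_append, formLanguage_map_terminal, formLanguage_map_nonterminal]
    rintro _ ⟨_, rfl, w, hw, rfl⟩
    exact append_mem_stackLanguage (fun z s => .single (move_of_step hstep z s))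
      (hl.prod_le_stackLanguage hw)

variable [Finite α] [Finite σ] [Finite Γ]

theorem finite_setOf_isTripleRule (M : DetPDA α σ Γ) : {r | M.IsTripleRule r}.Finite := by
  obtain ⟨k, hk⟩ := (Set.finite_range fun x : σ × Option α × Γ =>
    (M.step x.1 x.2.1 x.2.2).elim 0 fun y => y.2.length).bddAbove
  refine (finite_setOf_output_length_le (1 + k)).subset ?_
  rintro _ (⟨_, _⟩ | @⟨q, p, o, Z, γ, t, l, hstep, hl⟩)
  · exact Nat.zero_le _
  · have hγ : γ.length ≤ k := by simpa [hstep] using hk ⟨(q, o, Z), rfl⟩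
    have ho : o.toList.length ≤ 1 := by cases o <;> simp
    simpa using Nat.add_le_add ho (hl.length_le.trans hγ)

/-- The context-free grammar that the triple construction assigns to a pushdown automaton. -/
noncomputable abbrev toGrammar (M : DetPDA α σ Γ) : ContextFreeGrammar α where
  NT := Triple σ Γ
  initial := (M.start, M.bottom, none)
  rules := M.finite_setOf_isTripleRule.toFinset

theorem produces_toGrammar {r : ContextFreeRule α (Triple σ Γ)} (hr : M.IsTripleRule r) :
    M.toGrammar.Produces [nonterminal r.input] r.output :=
  produces_of_mem_rules (M.finite_setOf_isTripleRule.mem_toFinset.2 hr)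

theorem language_toGrammar_le : M.toGrammar.language ≤ M.accepts := by
  intro w hw
  obtain ⟨f, hf, s, h⟩ := nonterminalLanguage_le (g := M.toGrammar)
    (I := fun X => M.stackLanguage X.1 [X.2.1] X.2.2)
    (fun r hr => formLanguage_le_of_isTripleRule
      (M.finite_setOf_isTripleRule.mem_toFinset.1 hr)) _ hw [] []
  rw [List.append_nil] at h
  exact ⟨f, hf, s, h⟩

theorem derives_of_step {q p : σ} {o : Option α} {Z : Γ} {γ : List Γ} {t : Option σ}
    {l : List (Triple σ Γ)} {w : List α} (hstep : M.step q o Z = some (p, γ))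
    (hl : M.Chain p γ t l) {l' : List (Triple σ Γ)}
    (hw : M.toGrammar.Derives ((l ++ l').map nonterminal) (w.map terminal)) :
    M.toGrammar.Derives (((q, Z, t) :: l').map nonterminal) ((o.toList ++ w).map terminal) := by
  have hrule := (produces_toGrammar (.step hstep hl)).append_right (l'.map nonterminal)
  refine hrule.trans_derives ?_
  simpa using hw.append_left (o.toList.map terminal)

theorem exists_chain_of_mem_acceptsFrom {q : σ} {s : List Γ} {w : List α}
    (h : w ∈ M.acceptsFrom q s) :
    ∃ l, M.Chain q s none l ∧ M.toGrammar.Derives (l.map nonterminal) (w.map terminal) := by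
  refine acceptsFrom_induction
    (P := fun q s w => ∃ l, M.Chain q s none l ∧
      M.toGrammar.Derives (l.map nonterminal) (w.map terminal))
    (fun q hq s => ⟨[], .halt hq s, .refl _⟩) (fun q o Z p γ s w hstep ih => ?_) h
  obtain ⟨l, hl, hw⟩ := ih
  rcases hl.of_append with ⟨l₁, r, l₂, rfl, h₁, h₂⟩ | ⟨-, hl⟩
  · exact ⟨_, h₂.pop q Z, derives_of_step hstep h₁ hw⟩
  · exact ⟨_, .last q Z s, derives_of_step hstep hl (by simpa using hw)⟩

theorem le_language_toGrammar : M.accepts ≤ M.toGrammar.language := by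
  intro w hw
  rcases mem_acceptsFrom_iff.1 hw with ⟨hq, rfl⟩ | ⟨o, Z, p, γ, w, s, hstep, rfl, heq, hw⟩
  · exact (produces_toGrammar (.accept hq M.bottom)).single
  · cases heq
    obtain ⟨l, hl, hw⟩ := exists_chain_of_mem_acceptsFrom hw
    rw [List.append_nil] at hl
    exact derives_of_step (l' := []) hstep hl (by simpa using hw)

theorem language_toGrammar : M.toGrammar.language = M.accepts :=
  le_antisymm language_toGrammar_le le_language_toGrammar

end DetPDA

namespace LanguageClass

theorem detContextFree_included_contextFree : detContextFree.Included contextFree := by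
  rintro α _ _ ⟨σ, Γ, _, _, M, rfl⟩
  exact ⟨M.toGrammar, DetPDA.language_toGrammar⟩

theorem detLinear_included_detContextFree : detLinear.Included detContextFree :=
  fun _ _ _ ⟨σ, Γ, hσ, hΓ, M, _, hM⟩ => ⟨σ, Γ, hσ, hΓ, M, hM⟩

end LanguageClass

/-! ### A deterministic automaton for a balanced language that is not context-free -/

/-- The automaton that deletes the letters `0, 1, …, n, 0, 1, …, n, …` in turn. It must find each
`0` at the beginning of the remaining word, but looks for any other letter in the whole word. -/
def cyclicAutomaton (n : ℕ) : NFAwntl (Fin (n + 1)) (Fin (n + 1)) where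
  translucent q := {_a | q ≠ 0}
  start := {0}
  accept := {0}
  step q a := {p | a = q ∧ p = q + 1}

theorem cyclicAutomaton_isDeterministic (n : ℕ) : (cyclicAutomaton n).IsDeterministic :=
  ⟨⟨0, rfl⟩, fun _ _ _ hp _ hp' => hp.2.trans hp'.2.symm⟩

theorem append_cons_mem_acceptsFrom_cyclicAutomaton {n : ℕ} {q p : Fin (n + 1)}
    {u v : List (Fin (n + 1))} (hq : q ≠ 0) (hp : p = q + 1)
    (h : u ++ v ∈ (cyclicAutomaton n).acceptsFrom p) :
    u ++ q :: v ∈ (cyclicAutomaton n).acceptsFrom q :=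
  NFAwntl.mem_acceptsFrom_of_move (.erase (fun _ _ => hq) ⟨rfl, hp⟩) h

theorem exists_count_add_eq_of_mem_acceptsFrom_cyclicAutomaton {n : ℕ} {q : Fin (n + 1)}
    {w : List (Fin (n + 1))} (h : w ∈ (cyclicAutomaton n).acceptsFrom q) :
    ∃ k, ∀ a, w.count a + (if a < q then 1 else 0) = k := by
  refine NFAwntl.acceptsFrom_induction
    (P := fun q w => ∃ k, ∀ a, w.count a + (if a < q then 1 else 0) = k)
    (fun q hq w hw => ?_) (fun q p u v b _ hp ih => ?_) h
  · obtain rfl : q = 0 := hq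
    obtain rfl : w = [] := List.eq_nil_iff_forall_not_mem.2 fun a ha => hw a ha rfl
    exact ⟨0, by simp⟩
  · obtain ⟨rfl, rfl⟩ := hp
    obtain ⟨k, hk⟩ := ih
    rcases Fin.eq_castSucc_or_eq_last b with ⟨b, rfl⟩ | rfl
    · refine ⟨k, fun a => ?_⟩
      rw [← hk a, Fin.coeSucc_eq_succ]
      grind
    · refine ⟨k + 1, fun a => ?_⟩
      rw [← hk a, Fin.last_add_one]
      grind

theorem isBalanced_accepts_cyclicAutomaton (n : ℕ) : IsBalanced (cyclicAutomaton n).accepts := by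
  rintro w ⟨_, rfl, h⟩ a b
  obtain ⟨k, hk⟩ := exists_count_add_eq_of_mem_acceptsFrom_cyclicAutomaton h
  simpa using (hk a).trans (hk b).symm

theorem langADCB_le_accepts_cyclicAutomaton : langADCB ≤ (cyclicAutomaton 3).accepts := by
  rintro _ ⟨m, rfl⟩
  refine NFAwntl.mem_accepts_iff.2 ⟨0, rfl, ?_⟩
  induction m with
  | zero => exact NFAwntl.mem_acceptsFrom_of_translucent rfl (by simp)
  | succ m ih =>
    have h₃ := append_cons_mem_acceptsFrom_cyclicAutomaton (n := 3) (q := 3) (p := 0)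
      (u := .replicate m 0) (v := .replicate m 3 ++ .replicate m 2 ++ .replicate m 1)
      (by decide) rfl (by simpa using ih)
    have h₂ := append_cons_mem_acceptsFrom_cyclicAutomaton (n := 3) (q := 2) (p := 3)
      (u := .replicate m 0 ++ .replicate (m + 1) 3) (v := .replicate m 2 ++ .replicate m 1)
      (by decide) rfl (by simpa [List.replicate_succ] using h₃)
    have h₁ := append_cons_mem_acceptsFrom_cyclicAutomaton (n := 3) (q := 1) (p := 2)
      (u := .replicate m 0 ++ .replicate (m + 1) 3 ++ .replicate (m + 1) 2) (v := .replicate m 1)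
      (by decide) rfl (by simpa [List.replicate_succ] using h₂)
    exact NFAwntl.cons_mem_acceptsFrom (p := 1) ⟨rfl, rfl⟩
      (by simpa [List.replicate_succ] using h₁)

section LangADCB

variable {L : Language (Fin 4)}

theorem blocks_mem_iff_of_langADCB_le (hL : IsBalanced L) (hle : langADCB ≤ L) {i j k l : ℕ} :
    List.replicate i 0 ++ List.replicate j 3 ++ List.replicate k 2 ++ List.replicate l 1 ∈ L ↔
      i = j ∧ i = k ∧ i = l := by
  constructor
  · intro h
    refine ⟨?_, ?_, ?_⟩
    · simpa [List.count_replicate] using hL _ h 0 3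
    · simpa [List.count_replicate] using hL _ h 0 2
    · simpa [List.count_replicate] using hL _ h 0 1
  · rintro ⟨rfl, rfl, rfl⟩
    exact hle ⟨i, rfl⟩

theorem inf_langBlocks_of_langADCB_le (hL : IsBalanced L) (hle : langADCB ≤ L) :
    L ⊓ langBlocks = langADCB := by
  refine le_antisymm ?_ (le_inf hle fun w ⟨n, hw⟩ => ⟨n, n, n, n, hw⟩)
  rintro _ ⟨h, i, j, k, l, rfl⟩
  obtain ⟨rfl, rfl, rfl⟩ := (blocks_mem_iff_of_langADCB_le hL hle).1 h
  exact ⟨i, rfl⟩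

theorem not_isRegular_of_langADCB_le (hL : IsBalanced L) (hle : langADCB ≤ L) :
    ¬ L.IsRegular :=
  not_isRegular_of_fooling (fun i : ℕ => List.replicate i 0)
    (fun j => List.replicate j 3 ++ List.replicate j 2 ++ List.replicate j 1) fun i j => by
    simpa using blocks_mem_iff_of_langADCB_le hL hle (i := i) (j := j) (k := j) (l := j)

theorem notMem_or_notMem_of_infix {α : Type*} {p y s x : List α} {a b : α}
    (hx : x <:+: p ++ (y ++ s)) (hlength : x.length ≤ y.length) (ha : a ∉ y ++ s)
    (hb : b ∉ p ++ y) : a ∉ x ∨ b ∉ x := by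
  obtain ⟨u, v, huv⟩ := hx
  rcases le_total p.length u.length with hpu | hup
  · have hsuffix : x ++ v <:+ y ++ s := by
      refine List.suffix_of_suffix_length_le (l₃ := p ++ (y ++ s)) ⟨u, by simpa using huv⟩
        ⟨p, rfl⟩ ?_
      have := congrArg List.length huv
      simp only [List.length_append] at this ⊢
      omega
    exact .inl fun h => ha (hsuffix.subset (List.mem_append_left v h))
  · have hprefix : u ++ x <+: p ++ y :=
      List.prefix_of_prefix_length_le (l₃ := p ++ (y ++ s)) ⟨v, huv⟩ ⟨s, by simp⟩
        (by simpa using Nat.add_le_add hup hlength)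
    exact .inr fun h => hb (hprefix.subset (List.mem_append_right u h))

theorem not_isContextFree_of_langADCB_le (hL : IsBalanced L) (hle : langADCB ≤ L) :
    ¬ L.IsContextFree := by
  refine hL.not_isContextFree fun n => ⟨_, hle ⟨n, rfl⟩, by simp, fun x hx hn => ?_⟩
  have hmissing : 0 ∉ x ∨ 1 ∉ x :=
    notMem_or_notMem_of_infix (p := .replicate n 0) (y := .replicate n 3 ++ .replicate n 2)
      (s := .replicate n 1) (by simpa using hx) (hn.trans (by simp)) (by simp) (by simp)
  exact hmissing.elim (fun h => ⟨0, h⟩) fun h => ⟨1, h⟩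

theorem isBalanced_langADCB : IsBalanced langADCB :=
  (isBalanced_accepts_cyclicAutomaton 3).mono langADCB_le_accepts_cyclicAutomaton

end LangADCB

theorem dfaWNTL_cyclicAutomaton (n : ℕ) :
    LanguageClass.dfaWNTL (Fin (n + 1)) (cyclicAutomaton n).accepts :=
  ⟨_, inferInstance, cyclicAutomaton n, cyclicAutomaton_isDeterministic n, rfl⟩

/-! ### The language `{aⁿbⁿ}` -/

theorem replicate_append_replicate_mem_langAB_iff {n m : ℕ} :
    List.replicate n 0 ++ List.replicate m 1 ∈ langAB ↔ n = m := by
  constructor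
  · rintro ⟨k, hk⟩
    have hn : n = k := by simpa [List.count_replicate] using congrArg (List.count 0) hk
    have hm : m = k := by simpa [List.count_replicate] using congrArg (List.count 1) hk
    exact hn.trans hm.symm
  · rintro rfl
    exact ⟨n, rfl⟩

theorem not_isRegular_langAB : ¬ langAB.IsRegular :=
  not_isRegular_of_fooling (fun i : ℕ => List.replicate i 0) (fun j => List.replicate j 1)
    fun _ _ => replicate_append_replicate_mem_langAB_iff

theorem eq_of_perm_of_mem_langAB {x y : List (Fin 2)} (hx : x ∈ langAB) (hy : y ∈ langAB)
    (h : x.Perm y) : x = y := by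
  obtain ⟨n, rfl⟩ := hx
  obtain ⟨m, rfl⟩ := hy
  obtain rfl : n = m := by simpa [List.count_replicate] using h.count_eq 0
  rfl

theorem not_exists_isRegular_letterEquivalent_langAB :
    ¬ ∃ R : Language (Fin 2), R ≤ langAB ∧ R.IsRegular ∧ LetterEquivalent R langAB := by
  rintro ⟨R, hle, hR, -, hsurj⟩
  have hge : langAB ≤ R := fun x hx => by
    obtain ⟨y, hy, hyx⟩ := hsurj x hx
    rwa [← eq_of_perm_of_mem_langAB (hle hy) hx hyx]
  exact not_isRegular_langAB (le_antisymm hle hge ▸ hR)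

theorem not_nfaWNTL_langAB : ¬ LanguageClass.nfaWNTL (Fin 2) langAB := by
  rintro ⟨σ, _, M, hM⟩
  exact not_exists_isRegular_letterEquivalent_langAB (hM ▸ M.exists_isRegular_letterEquivalent)

/-- The two-head automaton that reads one `a` from the left and one `b` from the right. -/
def twoHeadAB : TwoHeadFA (Fin 2) Unit where
  trans := {((), [0], [1], ())}
  start := ()
  accept := Set.univ

theorem twoHeadAB_move_iff {c c' : Unit × List (Fin 2)} :
    twoHeadAB.Move c c' ↔ c.2 = 0 :: c'.2 ++ [1] := by
  constructor
  · rintro ⟨h⟩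
    simp only [twoHeadAB, Finset.mem_singleton, Prod.mk.injEq] at h
    obtain ⟨-, rfl, rfl, -⟩ := h
    rfl
  · obtain ⟨⟨⟩, w⟩ := c
    rintro rfl
    exact .read (u := [0]) (v := [1]) (Finset.mem_singleton_self _)

theorem twoHeadAB_isDeterministic : twoHeadAB.IsDeterministic := by
  intro c c₁ c₂ h₁ h₂
  rw [twoHeadAB_move_iff] at h₁ h₂
  refine Prod.ext rfl ?_
  simpa using h₁.symm.trans h₂

theorem accepts_twoHeadAB : twoHeadAB.accepts = langAB := by
  have hsucc (n : ℕ) : List.replicate (n + 1) (0 : Fin 2) ++ List.replicate (n + 1) 1 =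
      0 :: (List.replicate n 0 ++ List.replicate n 1) ++ [1] := by
    rw [List.replicate_succ, List.replicate_succ' (a := (1 : Fin 2))]
    simp
  ext w
  constructor
  · rintro ⟨_, -, h⟩
    generalize hc : (twoHeadAB.start, w) = c at h
    induction h using Relation.ReflTransGen.head_induction_on generalizing w with
    | refl => cases hc; exact ⟨0, rfl⟩
    | head hmove _ ih =>
      obtain ⟨n, hn⟩ := ih _ rfl
      subst hc
      exact ⟨n + 1, by rw [hsucc, ← hn]; exact twoHeadAB_move_iff.1 hmove⟩
  · rintro ⟨n, rfl⟩
    refine ⟨(), trivial, ?_⟩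
    induction n with
    | zero => exact .refl
    | succ n ih => exact .head (twoHeadAB_move_iff.2 (hsucc n)) ih

theorem twoDetLIN_langAB : LanguageClass.twoDetLIN (Fin 2) langAB :=
  ⟨Unit, inferInstance, twoHeadAB, twoHeadAB_isDeterministic, accepts_twoHeadAB⟩

/-! ### A one-turn pushdown automaton for `{aⁿbⁿ}` -/

namespace DetPDA

variable {α σ Γ : Type} {M : DetPDA α σ Γ}

theorem isOneTurn_of_step (S : Set σ)
    (hpop : ∀ q o Z, ∀ x ∈ M.step q o Z, x.2 = [] → x.1 ∈ S)
    (hS : ∀ q ∈ S, ∀ o Z, ∀ x ∈ M.step q o Z, x.1 ∈ S ∧ x.2.length ≤ 1) : M.IsOneTurn := by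
  have hstay {c c'} (h : M.Move c c') (hc : c.1 ∈ S) :
      c'.1 ∈ S ∧ c'.2.2.length ≤ c.2.2.length := by
    obtain ⟨q, o, Z, p, γ, w, s, hstep, rfl, rfl⟩ := exists_step_of_move h
    obtain ⟨hp, hγ⟩ := hS q hc o Z _ hstep
    exact ⟨hp, by simpa [add_comm s.length] using hγ⟩
  intro w c₁ c₂ c₃ c₄ _ h₁₂ hdecrease h₂₃ h₃₄
  have hc₂ : c₂.1 ∈ S := by
    obtain ⟨q, o, Z, p, γ, w, s, hstep, rfl, rfl⟩ := exists_step_of_move h₁₂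
    exact hpop q o Z _ hstep (by simpa using hdecrease)
  have hc₃ : c₃.1 ∈ S := by
    clear h₃₄
    induction h₂₃ with
    | refl => exact hc₂
    | tail _ h ih => exact (hstay h ih).1
  exact (hstay h₃₄ hc₃).2

theorem mem_acceptsFrom_nil_iff {q : σ} {w : List α} :
    w ∈ M.acceptsFrom q [] ↔ q ∈ M.accept ∧ w = [] := by
  rw [mem_acceptsFrom_iff]
  simp

theorem nil_mem_acceptsFrom_iff {q : σ} {s : List Γ} (h : ∀ Z, M.step q none Z = none) :
    [] ∈ M.acceptsFrom q s ↔ q ∈ M.accept := by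
  rw [mem_acceptsFrom_iff]
  simp [Option.exists, h]

theorem cons_notMem_acceptsFrom {q : σ} {s : List Γ} {a : α} {w : List α}
    (h : ∀ Z, M.step q none Z = none) (ha : ∀ Z, M.step q (some a) Z = none) :
    a :: w ∉ M.acceptsFrom q s := by
  rw [mem_acceptsFrom_iff]
  simp [Option.exists, h, ha]

theorem cons_mem_acceptsFrom_cons_iff {q p : σ} {Z : Γ} {γ s : List Γ} {a : α} {w : List α}
    (h : M.step q (some a) Z = some (p, γ)) :
    a :: w ∈ M.acceptsFrom q (Z :: s) ↔ w ∈ M.acceptsFrom p (γ ++ s) := by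
  have hnone : M.step q none Z = none := by
    by_contra hne
    simp [M.det q Z hne a] at h
  rw [mem_acceptsFrom_iff]
  simp [Option.exists, hnone, h]

end DetPDA

/-- A pushdown automaton for `{aⁿbⁿ}` that reads a letter in each move. Reading the letters `a`, it
pushes a symbol `true` for each of them but the first. State `1` is for reading `a`, state `2` for
reading `b`, and state `3` is entered with the empty stack once all the symbols are removed. -/
def pdaAB : DetPDA (Fin 2) (Fin 4) Bool where
  step
    | 0, some 0, false => some (1, [false])
    | 1, some 0, Z => some (1, [true, Z])
    | 1, some 1, Z | 2, some 1, Z => some (if Z then 2 else 3, [])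
    | _, _, _ => none
  start := 0
  bottom := false
  accept := {0, 3}
  det := by decide

theorem pdaAB_step_none (q : Fin 4) (Z : Bool) : pdaAB.step q none Z = none := by
  revert q Z
  decide

theorem pdaAB_step_zero_zero : pdaAB.step 0 (some 0) false = some (1, [false]) :=
  rfl

theorem pdaAB_step_one_zero (Z : Bool) : pdaAB.step 1 (some 0) Z = some (1, [true, Z]) :=
  rfl

theorem pdaAB_accept : pdaAB.accept = {0, 3} :=
  rfl

theorem pdaAB_isOneTurn : pdaAB.IsOneTurn :=
  DetPDA.isOneTurn_of_step {q | 2 ≤ q} (by decide) (by decide)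

theorem one_cons_mem_acceptsFrom_pdaAB_iff {q : Fin 4} (hq : q = 1 ∨ q = 2) {k : ℕ}
    {w : List (Fin 2)} :
    1 :: w ∈ pdaAB.acceptsFrom q (List.replicate k true ++ [false]) ↔ w = List.replicate k 1 := by
  induction k generalizing q w with
  | zero =>
    have hstep : pdaAB.step q (some 1) false = some (3, []) := by rcases hq with rfl | rfl <;> rfl
    exact ((DetPDA.cons_mem_acceptsFrom_cons_iff hstep).trans DetPDA.mem_acceptsFrom_nil_iff).trans
      (and_iff_right (Or.inr rfl))
  | succ k ih =>
    have hstep : pdaAB.step q (some 1) true = some (2, []) := by rcases hq with rfl | rfl <;> rfl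
    refine (DetPDA.cons_mem_acceptsFrom_cons_iff hstep).trans ?_
    match w with
    | [] =>
      simp [DetPDA.nil_mem_acceptsFrom_iff (pdaAB_step_none 2), pdaAB_accept]
    | 0 :: w =>
      refine iff_of_false (DetPDA.cons_notMem_acceptsFrom (pdaAB_step_none 2) fun Z => rfl) ?_
      simp [List.replicate_succ]
    | 1 :: w => simpa [List.replicate_succ] using ih (.inr rfl)

theorem mem_acceptsFrom_one_pdaAB_iff {k : ℕ} {w : List (Fin 2)} :
    w ∈ pdaAB.acceptsFrom 1 (List.replicate k true ++ [false]) ↔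
      ∃ j, w = List.replicate j 0 ++ List.replicate (j + k + 1) 1 := by
  induction w generalizing k with
  | nil => simp [DetPDA.nil_mem_acceptsFrom_iff (pdaAB_step_none 1), pdaAB_accept]
  | cons a w ih =>
    match a with
    | 0 =>
      have hpush : 0 :: w ∈ pdaAB.acceptsFrom 1 (List.replicate k true ++ [false]) ↔
          w ∈ pdaAB.acceptsFrom 1 (List.replicate (k + 1) true ++ [false]) := by
        cases k <;> exact DetPDA.cons_mem_acceptsFrom_cons_iff (pdaAB_step_one_zero _)
      rw [hpush, ih, ← Nat.or_exists_add_one (p := fun j => 0 :: w = _)]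
      simp [List.replicate_succ, Nat.add_right_comm, Nat.add_assoc]
    | 1 =>
      rw [one_cons_mem_acceptsFrom_pdaAB_iff (.inl rfl), ← Nat.or_exists_add_one]
      simp [List.replicate_succ]

theorem accepts_pdaAB : pdaAB.accepts = langAB := by
  ext w
  change w ∈ pdaAB.acceptsFrom 0 [false] ↔ _
  match w with
  | [] =>
    exact iff_of_true ((DetPDA.nil_mem_acceptsFrom_iff (pdaAB_step_none 0)).2 (.inl rfl)) ⟨0, rfl⟩
  | 0 :: w =>
    refine ((DetPDA.cons_mem_acceptsFrom_cons_iff pdaAB_step_zero_zero).trans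
      (mem_acceptsFrom_one_pdaAB_iff (k := 0))).trans ?_
    change _ ↔ ∃ n, 0 :: w = _
    conv_rhs => rw [← Nat.or_exists_add_one]
    simp [List.replicate_succ]
  | 1 :: w =>
    refine iff_of_false (DetPDA.cons_notMem_acceptsFrom (pdaAB_step_none 0) fun Z => rfl) ?_
    change ¬ ∃ n, 1 :: w = _
    rw [← Nat.or_exists_add_one]
    simp [List.replicate_succ]

theorem detLinear_langAB : LanguageClass.detLinear (Fin 2) langAB :=
  ⟨Fin 4, Bool, inferInstance, inferInstance, pdaAB, pdaAB_isOneTurn, accepts_pdaAB⟩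

/-! ### Comparing the classes -/

namespace LanguageClass

theorem regular_included_dfaWNTL : regular.Included dfaWNTL := by
  rintro α _ _ ⟨σ, hσ, D, rfl⟩
  exact ⟨σ, hσ, NFAwntl.ofDFA D, NFAwntl.ofDFA_isDeterministic D, NFAwntl.accepts_ofDFA D⟩

theorem dfaWNTL_included_nfaWNTL : dfaWNTL.Included nfaWNTL :=
  fun _ _ _ ⟨σ, hσ, M, _, hM⟩ => ⟨σ, hσ, M, hM⟩

theorem Included.refl (C : LanguageClass) : C.Included C :=
  fun _ _ _ h => h

theorem Included.trans {C D E : LanguageClass} (h : C.Included D) (h' : D.Included E) :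
    C.Included E :=
  fun α _ L hL => h' α L (h α L hL)

theorem properlyIncluded_of_dfaWNTL_included {C : LanguageClass} (h : dfaWNTL.Included C) :
    regular.ProperlyIncluded C :=
  ⟨regular_included_dfaWNTL.trans h, fun hC =>
    not_isRegular_of_langADCB_le (isBalanced_accepts_cyclicAutomaton 3)
      langADCB_le_accepts_cyclicAutomaton (hC _ _ (h _ _ (dfaWNTL_cyclicAutomaton 3)))⟩

theorem incomparable_of_included {C D : LanguageClass} (hdfa : dfaWNTL.Included C)
    (hnfa : C.Included nfaWNTL) (hcf : D.Included contextFree) (hD : D (Fin 2) langAB) :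
    C.Incomparable D :=
  ⟨fun h => not_isContextFree_of_langADCB_le (isBalanced_accepts_cyclicAutomaton 3)
      langADCB_le_accepts_cyclicAutomaton (hcf _ _ (h _ _ (hdfa _ _ (dfaWNTL_cyclicAutomaton 3)))),
    fun h => not_nfaWNTL_langAB (hnfa _ _ (h _ _ hD))⟩

theorem linear_langAB : linear (Fin 2) langAB :=
  twoDetLIN_included_linear _ _ twoDetLIN_langAB

theorem detContextFree_langAB : detContextFree (Fin 2) langAB :=
  detLinear_included_detContextFree _ _ detLinear_langAB

theorem contextFree_langAB : contextFree (Fin 2) langAB :=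
  linear_included_contextFree _ _ linear_langAB

end LanguageClass

theorem mainTheorem1 :
    -- both classes properly include the regular languages
    LanguageClass.regular.ProperlyIncluded LanguageClass.nfaWNTL ∧
    LanguageClass.regular.ProperlyIncluded LanguageClass.dfaWNTL ∧
    -- both classes are incomparable with each of the five classes
    (∀ C ∈ ({LanguageClass.nfaWNTL, LanguageClass.dfaWNTL} : Set LanguageClass),
      ∀ D ∈ ({LanguageClass.detLinear, LanguageClass.twoDetLIN, LanguageClass.linear,
          LanguageClass.detContextFree, LanguageClass.contextFree} : Set LanguageClass),
        C.Incomparable D) ∧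
    -- a language of a DFAwntl that is not context-free
    (∃ L : Language (Fin 4), LanguageClass.dfaWNTL (Fin 4) L ∧
      L ⊓ langBlocks = langADCB ∧ ¬ langADCB.IsContextFree ∧ ¬ L.IsContextFree) ∧
    -- `{aⁿbⁿ}` is in the five classes, but is not accepted by any NFAwntl
    (LanguageClass.detLinear (Fin 2) langAB ∧ LanguageClass.twoDetLIN (Fin 2) langAB ∧
      LanguageClass.linear (Fin 2) langAB ∧ LanguageClass.detContextFree (Fin 2) langAB ∧
      LanguageClass.contextFree (Fin 2) langAB ∧
      (¬ ∃ R : Language (Fin 2), R ≤ langAB ∧ R.IsRegular ∧ LetterEquivalent R langAB) ∧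
      ¬ LanguageClass.nfaWNTL (Fin 2) langAB) := by
  open LanguageClass in
  have hbalanced := isBalanced_accepts_cyclicAutomaton 3
  have hle := langADCB_le_accepts_cyclicAutomaton
  refine ⟨properlyIncluded_of_dfaWNTL_included dfaWNTL_included_nfaWNTL,
    properlyIncluded_of_dfaWNTL_included (.refl _), ?_,
    ⟨_, dfaWNTL_cyclicAutomaton 3, inf_langBlocks_of_langADCB_le hbalanced hle,
      not_isContextFree_of_langADCB_le isBalanced_langADCB le_rfl,
      not_isContextFree_of_langADCB_le hbalanced hle⟩,
    detLinear_langAB, twoDetLIN_langAB, linear_langAB, detContextFree_langAB, contextFree_langAB,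
    not_exists_isRegular_letterEquivalent_langAB, not_nfaWNTL_langAB⟩
  intro C hC D hD
  obtain ⟨hdfa, hnfa⟩ : dfaWNTL.Included C ∧ C.Included nfaWNTL := by
    rcases hC with rfl | rfl
    · exact ⟨dfaWNTL_included_nfaWNTL, .refl _⟩
    · exact ⟨.refl _, dfaWNTL_included_nfaWNTL⟩
  obtain ⟨hcf, hAB⟩ : D.Included contextFree ∧ D (Fin 2) langAB := by
    rcases hD with rfl | rfl | rfl | rfl | rfl
    · exact ⟨detLinear_included_detContextFree.trans detContextFree_included_contextFree,
        detLinear_langAB⟩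
    · exact ⟨twoDetLIN_included_linear.trans linear_included_contextFree, twoDetLIN_langAB⟩
    · exact ⟨linear_included_contextFree, linear_langAB⟩
    · exact ⟨detContextFree_included_contextFree, detContextFree_langAB⟩
    · exact ⟨.refl _, contextFree_langAB⟩
  exact incomparable_of_included hdfa hnfa hcf hAB
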